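/- Throughout, for an alphabet $\mathcal X$ let $F(\mathcal X)$ be the free group on $\mathcal X$. An $L$-presentation $\langle \mathcal X \mid \mathcal Q \mid \Phi \mid \mathcal R\rangle$ consists of an alphabet $\mathcal X$, subsets $\mathcal Q,\mathcal R \subseteq F(\mathcal X)$ and a set $\Phi$ of endomorphisms of $F(\mathcal X)$; it defines the group $F(\mathcal X)/K$, where $K$ is the normal closure in $F(\mathcal X)$ of $\mathcal Q \cup \bigcup_{\sigma\in\Phi^*} \sigma(\mathcal R)$ and $\Phi^*\subseteq \mathrm{End}(F(\mathcal X))$ is the monoid generated by $\Phi$. It is finite if $\mathcal X,\mathcal Q,\Phi,\mathcal R$ are all finite, and invariant if $\varphi(K)\subseteq K$ for every $\varphi\in\Phi$. A group is invariantly finitely $L$-presented if it is isomorphic to the group defined by some $L$-presentation that is both finite and invariant. Theorem. Let $G$ be a finitely presented group and let $H$ be a finitely generated normal subgroup of $G$ with $G/H \cong \mathbb Z\times\mathbb Z$. Then $H$ is invariantly finitely $L$-presented. -/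

import Mathlib

/-- An `L`-presentation `⟨X | Q | Φ | R⟩` over the alphabet `X`. -/
structure LPresentation (X : Type*) where
  /-- The fixed relations `Q`. -/
  fixedRels : Set (FreeGroup X)
  /-- The substitutions `Φ`, endomorphisms of the free group on `X`. -/
  substitutions : Set (Monoid.End (FreeGroup X))
  /-- The iterated relations `R`. -/
  iteratedRels : Set (FreeGroup X)

namespace LPresentation

/-- The relators `Q ∪ ⋃ σ ∈ Φ*, σ(R)`, where `Φ*` is the monoid of endomorphisms
generated by `Φ`. -/
def relators {X : Type*} (P : LPresentation X) : Set (FreeGroup X) :=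
  P.fixedRels ∪ ⋃ σ ∈ Submonoid.closure P.substitutions, σ '' P.iteratedRels

/-- The group defined by an `L`-presentation. -/
abbrev DefinedGroup {X : Type*} (P : LPresentation X) : Type _ :=
  PresentedGroup P.relators

/-- The generators, fixed relations, substitutions and iterated relations are all finite. -/
def IsFinite {X : Type*} (P : LPresentation X) : Prop :=
  Finite X ∧ P.fixedRels.Finite ∧ P.substitutions.Finite ∧ P.iteratedRels.Finite

/-- An `L`-presentation is invariant if every substitution induces an endomorphism of the group
it defines, i.e. maps the normal closure of the relators into itself. -/
def IsInvariant {X : Type*} (P : LPresentation X) : Prop :=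
  ∀ φ ∈ P.substitutions, ∀ w ∈ Subgroup.normalClosure P.relators,
    φ w ∈ Subgroup.normalClosure P.relators

end LPresentation

/-- A group is invariantly finitely `L`-presented if it is isomorphic to the group defined by an
`L`-presentation that is both finite and invariant. (As the alphabet is finite, nothing is lost by
taking it in the lowest universe.) -/
def IsInvariantlyFinitelyLPresented (H : Type*) [Group H] : Prop :=
  ∃ (X : Type) (P : LPresentation X), P.IsFinite ∧ P.IsInvariant ∧ Nonempty (H ≃* P.DefinedGroup)

/-!
The group `G` is generated by `H` and two elements `s`, `t` lifting a basis of `G ⧸ H ≅ ℤ × ℤ`. Let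
`p : F(X) → H` be onto with `X` finite. Choose endomorphisms `φ, φ', ψ, ψ'` of `F(X)` covering
conjugation by `s, s⁻¹, t, t⁻¹`, and a word `w` with `p w = t s t⁻¹ s⁻¹`. They are the substitutions
of the `L`-presentation of `H`; with no fixed relations, invariance is automatic.

Take first the iterated relations `R₀` saying that `φ φ'`, `φ' φ`, `ψ ψ'`, `ψ' ψ` fix every
generator and that `ψ φ` is `φ ψ` followed by conjugation by `w`. In the resulting group `N` the
substitutions become automorphisms `σ`, `τ` with `τ σ = conj w ∘ σ τ`, which is what is needed to
extend `τ` to `N ⋊ ℤ`, where `ℤ` acts by `σ`, and so to form `E = (N ⋊ ℤ) ⋊ ℤ`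
(`CyclicExtension.extend`). The natural map `E → G` is onto and is an isomorphism on the quotients
`ℤ × ℤ`, so its kernel is contained in `N`. As `G` is finitely presented and `E` finitely generated,
the kernel is the normal closure in `E` of a finite set
(`MonoidHom.isFinitelyNormallyGenerated_ker_of_surjective`). A normal subgroup of `N` stable under
`σ^±1` and `τ^±1` is normal in `E` (`CyclicExtension.normal_map_inl`), so the kernel of `N → H` is the
smallest such subgroup containing that finite set. Adding lifts of the finite set to `R₀` gives the
presentation of `H`.
-/

/-! ### Finitely presented quotients of finitely generated groups -/

/-- The kernel is normally generated by the relators of `G`, rewritten in terms of lifts to `E` of the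
generators of `G`, together with relations expressing the generators of `E` through these lifts. -/
theorem MonoidHom.isFinitelyNormallyGenerated_ker_of_surjective {E G : Type*} [Group E] [Group G]
    [Group.FG E] [hG : Group.IsFinitelyPresented G] (f : E →* G) (hf : Function.Surjective f) :
    f.ker.IsFinitelyNormallyGenerated := by
  obtain ⟨n, φ, hφ, S, hSfin, hS⟩ := hG.out
  obtain ⟨B, hB, hBfin⟩ := Group.fg_iff.1 ‹Group.FG E›
  choose lft hlft using hf
  choose word hword using hφ
  let α : FreeGroup (Fin n) →* E := FreeGroup.lift fun i => lft (φ (FreeGroup.of i))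
  have hα : f.comp α = φ := by
    ext i
    simp [α, hlft]
  have hα' (v) : f (α v) = φ v := DFunLike.congr_fun hα v
  let T : Set E := α '' S ∪ (fun b => b⁻¹ * α (word (f b))) '' B
  have hle : Subgroup.normalClosure T ≤ f.ker := by
    refine Subgroup.normalClosure_le_normal ?_
    rintro _ (⟨r, hr, rfl⟩ | ⟨b, -, rfl⟩)
    · have : r ∈ φ.ker := hS ▸ Subgroup.subset_normalClosure hr
      simpa [MonoidHom.mem_ker, hα'] using this
    · simp [MonoidHom.mem_ker, hα', hword]
  refine ⟨T, (hSfin.image _).union (hBfin.image _), le_antisymm hle fun x hx => ?_⟩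
  let π := QuotientGroup.mk' (Subgroup.normalClosure T)
  -- Modulo `T`, the lift `α` is onto, since every generator `b` of `E` agrees with `α (word (f b))`.
  have hsurj : (π.comp α).range = ⊤ := by
    have hπ : π.range = ⊤ := MonoidHom.range_eq_top.2 (QuotientGroup.mk'_surjective _)
    rw [eq_top_iff, ← hπ, MonoidHom.range_eq_map, ← hB, MonoidHom.map_closure, Subgroup.closure_le]
    rintro _ ⟨b, hb, rfl⟩
    exact ⟨word (f b), ((QuotientGroup.eq (s := Subgroup.normalClosure T)).2
      (Subgroup.subset_normalClosure (Or.inr ⟨b, hb, rfl⟩))).symm⟩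
  obtain ⟨v, hv⟩ := MonoidHom.range_eq_top.1 hsurj (π x)
  have hxv : x⁻¹ * α v ∈ Subgroup.normalClosure T := QuotientGroup.eq.1 hv.symm
  have hvker : v ∈ Subgroup.normalClosure S := by
    have h1 := hle hxv
    rw [MonoidHom.mem_ker] at hx h1
    rw [hS, MonoidHom.mem_ker, ← hα']
    simpa [hx] using h1
  have hαv : α v ∈ Subgroup.normalClosure T := by
    have : Subgroup.normalClosure S ≤ (Subgroup.normalClosure T).comap α :=
      Subgroup.normalClosure_le_normal fun r hr => Subgroup.subset_normalClosure (Or.inl ⟨r, hr, rfl⟩)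
    exact this hvker
  simpa using (Subgroup.normalClosure T).mul_mem hαv ((Subgroup.normalClosure T).inv_mem hxv)

/-! ### Semidirect products with an infinite cyclic group -/

/-- The semidirect product `N ⋊ ℤ` in which the generator of `ℤ` acts on `N` by `σ`. -/
abbrev CyclicExtension {N : Type*} [Group N] (σ : MulAut N) : Type _ :=
  N ⋊[zpowersHom (MulAut N) σ] Multiplicative ℤ

namespace CyclicExtension

open SemidirectProduct

variable {N G : Type*} [Group N] [Group G] {σ : MulAut N}

theorem conj_zpow (f : N →* G) (s : G) (h : ∀ n, f (σ n) = s * f n * s⁻¹) (k : ℤ) (n : N) :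
    f ((σ ^ k) n) = s ^ k * f n * (s ^ k)⁻¹ := by
  have hinv (m) : f (σ⁻¹ m) = s⁻¹ * f m * s := by
    have := h (σ⁻¹ m)
    rw [MulAut.apply_inv_self] at this
    rw [this]; group
  induction k generalizing n with
  | zero => simp
  | succ k ih => rw [zpow_add_one, MulAut.mul_apply, ih, h, zpow_add_one]; group
  | pred k ih => rw [zpow_sub_one, MulAut.mul_apply, ih, hinv, zpow_sub_one]; group

/-- The homomorphism out of `N ⋊ ℤ` given by `f` on `N` and sending the generator of `ℤ` to `s`. -/
def lift (f : N →* G) (s : G) (h : ∀ n, f (σ n) = s * f n * s⁻¹) : CyclicExtension σ →* G :=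
  SemidirectProduct.lift f (zpowersHom G s) fun k => by
    ext n
    simpa [← map_zpow] using conj_zpow f s h k.toAdd n

/-- The generator of the factor `ℤ` of `N ⋊ ℤ`. -/
def gen (σ : MulAut N) : CyclicExtension σ := inr (Multiplicative.ofAdd 1)

@[simp]
theorem lift_inl (f : N →* G) (s : G) (h) (n : N) :
    lift (σ := σ) f s h (inl n) = f n := by simp [lift]

@[simp]
theorem lift_gen (f : N →* G) (s : G) (h) : lift (σ := σ) f s h (gen σ) = s := by
  simp [lift, gen]

theorem lift_apply (f : N →* G) (s : G) (h) (x : CyclicExtension σ) :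
    lift f s h x = f x.left * s ^ x.right.toAdd := by
  simp [lift, SemidirectProduct.lift]

theorem inl_apply (n : N) : (inl (σ n) : CyclicExtension σ) = gen σ * inl n * (gen σ)⁻¹ := by
  have := inl_aut (φ := zpowersHom (MulAut N) σ) (Multiplicative.ofAdd 1) n
  simpa [gen] using this

theorem hom_ext {f g : CyclicExtension σ →* G} (hl : ∀ n, f (inl n) = g (inl n))
    (hr : f (gen σ) = g (gen σ)) : f = g := by
  refine SemidirectProduct.hom_ext (MonoidHom.ext hl) ?_
  ext
  exact hr

instance [Group.FG N] : Group.FG (CyclicExtension σ) := by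
  obtain ⟨B, hB, hBfin⟩ := Group.fg_iff.1 ‹Group.FG N›
  refine Group.fg_iff.2 ⟨inl '' B ∪ {gen σ}, ?_, (hBfin.image _).union (Set.finite_singleton _)⟩
  rw [eq_top_iff]
  rintro x -
  rw [← inl_left_mul_inr_right x]
  refine mul_mem ?_ ?_
  · have : x.left ∈ Subgroup.closure B := hB ▸ Subgroup.mem_top _
    have h2 := Subgroup.mem_map_of_mem (inl : N →* CyclicExtension σ) this
    rw [MonoidHom.map_closure] at h2
    exact Subgroup.closure_mono Set.subset_union_left h2
  · have : (inr x.right : CyclicExtension σ) = gen σ ^ x.right.toAdd := by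
      rw [gen, ← map_zpow, ← ofAdd_zsmul, smul_eq_mul, mul_one, ofAdd_toAdd]
    rw [this]
    have hg : gen σ ∈ (inl '' B ∪ {gen σ} : Set (CyclicExtension σ)) := Or.inr rfl
    exact Subgroup.zpow_mem _ (Subgroup.subset_closure hg) _

/-- A normal subgroup of `N` stable under `σ` and `σ⁻¹` stays normal in `N ⋊ ℤ`. -/
theorem normal_map_inl {K : Subgroup N} [hK : K.Normal] (h : ∀ x ∈ K, σ x ∈ K)
    (h' : ∀ x ∈ K, σ⁻¹ x ∈ K) : (K.map (inl : N →* CyclicExtension σ)).Normal := by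
  have hz (k : ℤ) : ∀ x ∈ K, (σ ^ k) x ∈ K := by
    induction k with
    | zero => simp
    | succ k ih => intro x hx; rw [zpow_add_one]; exact ih _ (h x hx)
    | pred k ih => intro x hx; rw [zpow_sub_one]; exact ih _ (h' x hx)
  constructor
  rintro _ ⟨x, hx, rfl⟩ g
  refine ⟨g.left * (σ ^ g.right.toAdd) x * g.left⁻¹, hK.conj_mem _ (hz _ x hx) _, ?_⟩
  ext <;> simp

/-- If `τ` commutes with `σ` up to conjugation by `w`, then `τ` extends
to `N ⋊ ℤ` by sending the generator of `ℤ` to `w` times itself. -/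
def extend (τ : MulAut N) (w : N) (h : ∀ n, τ (σ n) = w * σ (τ n) * w⁻¹) :
    MulAut (CyclicExtension σ) :=
  MonoidHom.toMulEquiv
    (lift (inl.comp τ.toMonoidHom) (inl w * gen σ) fun n => by
      simp [h, inl_apply, mul_assoc])
    (lift (inl.comp τ.symm.toMonoidHom) (inl (τ.symm w)⁻¹ * gen σ) fun n => by
      have hn : τ.symm (σ n) = (τ.symm w)⁻¹ * σ (τ.symm n) * τ.symm w := by
        have := congrArg τ.symm (h (τ.symm n))
        simp only [MulEquiv.symm_apply_apply, MulEquiv.apply_symm_apply, map_mul, map_inv] at this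
        rw [this]; group
      simp [hn, inl_apply, mul_assoc])
    (hom_ext (by simp) (by simp))
    (hom_ext (by simp) (by simp))

@[simp]
theorem extend_inl (τ : MulAut N) (w : N) (h : ∀ n, τ (σ n) = w * σ (τ n) * w⁻¹) (n : N) :
    extend τ w h (inl n) = inl (τ n) := by simp [extend]

@[simp]
theorem extend_gen (τ : MulAut N) (w : N) (h : ∀ n, τ (σ n) = w * σ (τ n) * w⁻¹) :
    extend τ w h (gen σ) = inl w * gen σ := by simp [extend]

@[simp]
theorem extend_inv_inl (τ : MulAut N) (w : N) (h : ∀ n, τ (σ n) = w * σ (τ n) * w⁻¹) (n : N) :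
    (extend τ w h)⁻¹ (inl n) = inl (τ⁻¹ n) := by
  rw [MulAut.inv_apply, MulEquiv.symm_apply_eq, extend_inl, MulAut.apply_inv_self]

end CyclicExtension

/-! ### Kernels of maps to extensions by `ℤ × ℤ` -/

open SemidirectProduct CyclicExtension in
/-- If `G` is a finitely presented extension of `p(N)` by `ℤ × ℤ`, and the conjugations by the lifts
`s`, `t` of a basis come from automorphisms `σ`, `τ` of `N` that satisfy the corresponding
commutation rule, then `ker p` is generated by a finite set as a normal subgroup stable under
`σ`, `τ` and their inverses. -/
theorem exists_finite_relative_generators_ker {N G : Type*} [Group N] [Group G] [Group.FG N]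
    [Group.IsFinitelyPresented G] (p : N →* G) (σ τ : MulAut N) (w : N) (s t : G)
    (hs : ∀ n, p (σ n) = s * p n * s⁻¹) (ht : ∀ n, p (τ n) = t * p n * t⁻¹)
    (hw : p w = t * s * t⁻¹ * s⁻¹) (hτσ : ∀ n, τ (σ n) = w * σ (τ n) * w⁻¹)
    (hgen : ∀ g, ∃ (n : N) (i j : ℤ), p n * s ^ i * t ^ j = g)
    (hind : ∀ (n : N) (i j : ℤ), p n * s ^ i * t ^ j = 1 → i = 0 ∧ j = 0) :
    ∃ S : Set N, S.Finite ∧ S ⊆ p.ker ∧ ∀ K : Subgroup N, K.Normal → S ⊆ K →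
      (∀ x ∈ K, σ x ∈ K) → (∀ x ∈ K, σ⁻¹ x ∈ K) → (∀ x ∈ K, τ x ∈ K) → (∀ x ∈ K, τ⁻¹ x ∈ K) →
      p.ker ≤ K := by
  -- Both sides are homomorphisms in `m`; on the generator of `ℤ` they agree by `hw`.
  have hf (m) : lift p s hs (extend τ w hτσ m) = t * lift p s hs m * t⁻¹ := by
    have : (lift p s hs).comp (extend τ w hτσ).toMonoidHom =
        (MulAut.conj t).toMonoidHom.comp (lift p s hs) :=
      CyclicExtension.hom_ext (by simp [ht]) (by simp [hw])
    exact DFunLike.congr_fun this m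
  let f : CyclicExtension (extend τ w hτσ) →* G := lift (lift p s hs) t hf
  have hfx (x) : f x = p x.left.left * s ^ x.left.right.toAdd * t ^ x.right.toAdd := by
    simp [f, lift_apply]
  let ι : N →* CyclicExtension (extend τ w hτσ) := inl.comp inl
  have hι (n) : f (ι n) = p n := by simp [f, ι]
  have hιinj : Function.Injective ι := inl_injective.comp inl_injective
  have hsurj : Function.Surjective f := fun g => by
    obtain ⟨n, i, j, rfl⟩ := hgen g
    exact ⟨⟨⟨n, .ofAdd i⟩, .ofAdd j⟩, by simp [hfx]⟩
  obtain ⟨T, hTfin, hT⟩ := f.isFinitelyNormallyGenerated_ker_of_surjective hsurj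
  refine ⟨ι ⁻¹' T, hTfin.preimage hιinj.injOn, fun n hn => ?_, ?_⟩
  · have : ι n ∈ f.ker := hT ▸ Subgroup.subset_normalClosure hn
    simpa [MonoidHom.mem_ker, hι] using this
  intro K hK hSK hσ hσ' hτ hτ'
  have hK₁ : (K.map (inl : N →* CyclicExtension σ)).Normal := normal_map_inl hσ hσ'
  have hK₂ : ((K.map (inl : N →* CyclicExtension σ)).map
      (inl : _ →* CyclicExtension (extend τ w hτσ))).Normal := by
    refine normal_map_inl ?_ ?_
    · rintro _ ⟨x, hx, rfl⟩
      exact ⟨τ x, hτ x hx, by simp⟩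
    · rintro _ ⟨x, hx, rfl⟩
      exact ⟨τ⁻¹ x, hτ' x hx, by simp only [extend_inv_inl]⟩
  rw [Subgroup.map_map] at hK₂
  -- By `hind`, the kernel of `f` has trivial `ℤ`-components, so `T` comes from `N`.
  have hker : f.ker ≤ K.map ι := by
    rw [← hT]
    refine Subgroup.normalClosure_le_normal fun x hx => ?_
    have hx1 : f x = 1 := by
      have : x ∈ f.ker := hT ▸ Subgroup.subset_normalClosure hx
      exact this
    obtain ⟨hi, hj⟩ := hind _ _ _ ((hfx x).symm.trans hx1)
    have hxι : ι x.left.left = x := by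
      ext
      · rfl
      · exact hi.symm
      · exact hj.symm
    exact ⟨x.left.left, hSK (by rwa [Set.mem_preimage, hxι]), hxι⟩
  intro n hn
  obtain ⟨m, hm, hmn⟩ := hker (show ι n ∈ f.ker by rw [MonoidHom.mem_ker, hι]; exact hn)
  rwa [← hιinj hmn]

/-! ### Ascending `L`-presentations -/

namespace LPresentation

variable {X : Type*} {Φ : Set (Monoid.End (FreeGroup X))} {R : Set (FreeGroup X)}

/-- The ascending `L`-presentation `⟨X | ∅ | Φ | R⟩`, that is, one without fixed relations. -/
def ascending (Φ : Set (Monoid.End (FreeGroup X))) (R : Set (FreeGroup X)) : LPresentation X :=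
  ⟨∅, Φ, R⟩

theorem mem_relators_ascending {x : FreeGroup X} :
    x ∈ (ascending Φ R).relators ↔ ∃ σ ∈ Submonoid.closure Φ, ∃ r ∈ R, σ r = x := by
  simp [relators, ascending]

theorem subset_relators_ascending : R ⊆ (ascending Φ R).relators :=
  fun r hr => mem_relators_ascending.2 ⟨1, one_mem _, r, hr, rfl⟩

theorem relators_ascending_mono {R' : Set (FreeGroup X)} (h : R ⊆ R') :
    (ascending Φ R).relators ⊆ (ascending Φ R').relators := fun x hx => by
  obtain ⟨σ, hσ, r, hr, rfl⟩ := mem_relators_ascending.1 hx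
  exact mem_relators_ascending.2 ⟨σ, hσ, r, h hr, rfl⟩

theorem isInvariant_ascending : (ascending Φ R).IsInvariant := by
  intro φ hφ
  have : ((Subgroup.normalClosure (ascending Φ R).relators).comap φ).Normal :=
    Subgroup.Normal.comap inferInstance φ
  change _ ≤ (Subgroup.normalClosure (ascending Φ R).relators).comap φ
  refine Subgroup.normalClosure_le_normal fun x hx => Subgroup.subset_normalClosure ?_
  obtain ⟨σ, hσ, r, hr, rfl⟩ := mem_relators_ascending.1 hx
  exact mem_relators_ascending.2 ⟨φ * σ, mul_mem (Submonoid.subset_closure hφ) hσ, r, hr, rfl⟩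

/-- If each substitution covers conjugation by an element of `G` under `p`, then `p` kills all
relators as soon as it kills the iterated relations. -/
theorem normalClosure_relators_ascending_le_ker {G : Type*} [Group G] (p : FreeGroup X →* G)
    (hΦ : ∀ φ ∈ Φ, ∃ g : G, ∀ x, p (φ x) = g * p x * g⁻¹) (hR : R ⊆ p.ker) :
    Subgroup.normalClosure (ascending Φ R).relators ≤ p.ker := by
  refine Subgroup.normalClosure_le_normal fun x hx => ?_
  obtain ⟨σ, hσ, r, hr, rfl⟩ := mem_relators_ascending.1 hx
  have hσ' : ∀ y ∈ p.ker, σ y ∈ p.ker := by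
    clear hx
    induction hσ using Submonoid.closure_induction with
    | mem φ hφ =>
      intro y hy
      obtain ⟨g, hg⟩ := hΦ φ hφ
      rw [MonoidHom.mem_ker] at hy ⊢
      simp [hg, hy]
    | one => exact fun y hy => hy
    | mul φ ψ _ _ ihφ ihψ => exact fun y hy => ihφ _ (ihψ y hy)
  exact hσ' r (hR hr)

/-- The endomorphism of the defined group induced by a substitution. -/
def IsInvariant.induced {P : LPresentation X} (hP : P.IsInvariant)
    (φ : Monoid.End (FreeGroup X)) (hφ : φ ∈ P.substitutions) : P.DefinedGroup →* P.DefinedGroup :=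
  QuotientGroup.map _ _ φ (hP φ hφ)

@[simp]
theorem IsInvariant.induced_mk {P : LPresentation X} (hP : P.IsInvariant)
    (φ : Monoid.End (FreeGroup X)) (hφ : φ ∈ P.substitutions) (x : FreeGroup X) :
    hP.induced φ hφ (PresentedGroup.mk P.relators x) = PresentedGroup.mk P.relators (φ x) :=
  rfl

/-- The automorphism of the defined group induced by `φ`, with inverse induced by `ψ`, when the two
substitutions are mutually inverse on generators modulo relators. -/
def IsInvariant.inducedAut {P : LPresentation X} (hP : P.IsInvariant)
    (φ ψ : Monoid.End (FreeGroup X)) (hφ : φ ∈ P.substitutions) (hψ : ψ ∈ P.substitutions)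
    (hφψ : ∀ a, φ (ψ (.of a)) * (FreeGroup.of a)⁻¹ ∈ P.relators)
    (hψφ : ∀ a, ψ (φ (.of a)) * (FreeGroup.of a)⁻¹ ∈ P.relators) : MulAut P.DefinedGroup :=
  MonoidHom.toMulEquiv (hP.induced φ hφ) (hP.induced ψ hψ)
    (PresentedGroup.ext fun a => PresentedGroup.mk_eq_mk_of_mul_inv_mem (hψφ a))
    (PresentedGroup.ext fun a => PresentedGroup.mk_eq_mk_of_mul_inv_mem (hφψ a))

end LPresentation

/-- Conjugation by `g` on the normal subgroup `p.range` is covered by an endomorphism. -/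
theorem FreeGroup.exists_end_lift_conj {X G : Type*} [Group G] (p : FreeGroup X →* G)
    (hp : p.range.Normal) (g : G) :
    ∃ φ : Monoid.End (FreeGroup X), ∀ x, p (φ x) = g * p x * g⁻¹ := by
  choose u hu using fun a : X => hp.conj_mem _ ⟨FreeGroup.of a, rfl⟩ g
  refine ⟨FreeGroup.lift u, fun x => ?_⟩
  have : p.comp (FreeGroup.lift u) = (MulAut.conj g).toMonoidHom.comp p := by
    ext a
    simp [hu]
  exact DFunLike.congr_fun this x

/-! ### Normal subgroups with quotient `ℤ × ℤ` -/

open LPresentation in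
/-- The quotient `G ⧸ H ≅ ℤ × ℤ` enters only through `s` and `t`: every element of `G` is uniquely
`h * s ^ i * t ^ j` with `h ∈ H`. -/
theorem isInvariantlyFinitelyLPresented_of_freeGroup_hom {G : Type*} [Group G]
    [Group.IsFinitelyPresented G] {H : Subgroup G} [hHn : H.Normal] {X : Type} [Finite X]
    (p₀ : FreeGroup X →* H) (hp₀ : Function.Surjective p₀) (s t : G)
    (hcomm : t * s * t⁻¹ * s⁻¹ ∈ H) (hgen : ∀ g, ∃ h ∈ H, ∃ i j : ℤ, h * s ^ i * t ^ j = g)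
    (hind : ∀ h ∈ H, ∀ i j : ℤ, h * s ^ i * t ^ j = 1 → i = 0 ∧ j = 0) :
    IsInvariantlyFinitelyLPresented H := by
  let p : FreeGroup X →* G := H.subtype.comp p₀
  have hpH (x) : p x ∈ H := (p₀ x).2
  have hHp {h} (hh : h ∈ H) : ∃ x, p x = h := by
    obtain ⟨x, hx⟩ := hp₀ ⟨h, hh⟩
    exact ⟨x, congrArg Subtype.val hx⟩
  have hrange : p.range.Normal := by
    rw [show p.range = H from le_antisymm (by rintro _ ⟨x, rfl⟩; exact hpH x) fun h hh => hHp hh]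
    exact hHn
  obtain ⟨φ, hφ⟩ := FreeGroup.exists_end_lift_conj p hrange s
  obtain ⟨φ', hφ'⟩ := FreeGroup.exists_end_lift_conj p hrange s⁻¹
  obtain ⟨ψ, hψ⟩ := FreeGroup.exists_end_lift_conj p hrange t
  obtain ⟨ψ', hψ'⟩ := FreeGroup.exists_end_lift_conj p hrange t⁻¹
  obtain ⟨w, hw⟩ := hHp hcomm
  let Φ : Set (Monoid.End (FreeGroup X)) := {φ, φ', ψ, ψ'}
  have hφΦ : φ ∈ Φ := by simp [Φ]
  have hφΦ' : φ' ∈ Φ := by simp [Φ]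
  have hψΦ : ψ ∈ Φ := by simp [Φ]
  have hψΦ' : ψ' ∈ Φ := by simp [Φ]
  have hΦ : ∀ χ ∈ Φ, ∃ g : G, ∀ x, p (χ x) = g * p x * g⁻¹ := by
    rintro _ (rfl | rfl | rfl | rfl)
    exacts [⟨_, hφ⟩, ⟨_, hφ'⟩, ⟨_, hψ⟩, ⟨_, hψ'⟩]
  let inverseRel (χ χ' : Monoid.End (FreeGroup X)) (a : X) := χ (χ' (.of a)) * (FreeGroup.of a)⁻¹
  let commRel (a : X) := ψ (φ (.of a)) * (w * φ (ψ (.of a)) * w⁻¹)⁻¹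
  let R₀ : Set (FreeGroup X) :=
    Set.range (inverseRel φ φ') ∪ Set.range (inverseRel φ' φ) ∪ Set.range (inverseRel ψ ψ') ∪
      Set.range (inverseRel ψ' ψ) ∪ Set.range commRel
  have hR₀fin : R₀.Finite := by
    simp only [R₀, Set.finite_union, Set.finite_range, and_self]
  have hR₀ker : R₀ ⊆ p.ker := by
    rintro _ ((((⟨a, rfl⟩ | ⟨a, rfl⟩) | ⟨a, rfl⟩) | ⟨a, rfl⟩) | ⟨a, rfl⟩) <;>
      simp only [SetLike.mem_coe, MonoidHom.mem_ker, inverseRel, commRel, map_mul, map_inv, hφ, hφ',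
        hψ, hψ', hw] <;> group
  let P₀ := ascending Φ R₀
  have hP₀ : P₀.IsInvariant := isInvariant_ascending
  have hrel {r} (hr : r ∈ R₀) : r ∈ P₀.relators := subset_relators_ascending hr
  have hle₀ : Subgroup.normalClosure P₀.relators ≤ p.ker :=
    normalClosure_relators_ascending_le_ker p hΦ hR₀ker
  let σ : MulAut P₀.DefinedGroup := hP₀.inducedAut φ φ' hφΦ hφΦ'
    (fun a => hrel (by simp [R₀, inverseRel])) (fun a => hrel (by simp [R₀, inverseRel]))
  let τ : MulAut P₀.DefinedGroup := hP₀.inducedAut ψ ψ' hψΦ hψΦ'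
    (fun a => hrel (by simp [R₀, inverseRel])) (fun a => hrel (by simp [R₀, inverseRel]))
  let π : FreeGroup X →* P₀.DefinedGroup := PresentedGroup.mk P₀.relators
  have hπ : Function.Surjective π := PresentedGroup.mk_surjective _
  let pbar : P₀.DefinedGroup →* G := QuotientGroup.lift _ p hle₀
  have hpbar (x) : pbar (π x) = p x := rfl
  have hτσ : ∀ n, τ (σ n) = π w * σ (τ n) * (π w)⁻¹ := by
    have : τ.toMonoidHom.comp σ.toMonoidHom =
        (MulAut.conj (π w)).toMonoidHom.comp (σ.toMonoidHom.comp τ.toMonoidHom) :=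
      PresentedGroup.ext fun a => PresentedGroup.mk_eq_mk_of_mul_inv_mem
        (hrel (Or.inr ⟨a, rfl⟩))
    exact DFunLike.congr_fun this
  have : Group.FG P₀.DefinedGroup := Group.fg_of_surjective hπ
  obtain ⟨S, hSfin, hSker, hS⟩ := exists_finite_relative_generators_ker pbar σ τ (π w) s t
    (fun n => by obtain ⟨x, rfl⟩ := hπ n; exact hφ x)
    (fun n => by obtain ⟨x, rfl⟩ := hπ n; exact hψ x) hw hτσ
    (fun g => by
      obtain ⟨h, hh, i, j, rfl⟩ := hgen g
      obtain ⟨x, rfl⟩ := hHp hh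
      exact ⟨π x, i, j, rfl⟩)
    (fun n => by obtain ⟨x, rfl⟩ := hπ n; exact hind _ (hpH x))
  -- Add words representing the finitely many missing relations of `H` in `N`.
  let R := R₀ ∪ Function.surjInv hπ '' S
  let P := ascending Φ R
  have hker : Subgroup.normalClosure P.relators = p₀.ker := by
    have hpp₀ : p.ker = p₀.ker := by
      ext x
      simp [p, MonoidHom.mem_ker]
    rw [← hpp₀]
    refine le_antisymm (normalClosure_relators_ascending_le_ker p hΦ ?_) fun x hx => ?_
    · rintro _ (hr | ⟨n, hn, rfl⟩)
      · exact hR₀ker hr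
      · have := hSker hn
        rwa [SetLike.mem_coe, MonoidHom.mem_ker, ← Function.surjInv_eq hπ n, hpbar] at this
    · let K := (Subgroup.normalClosure P.relators).map π
      have hK {χ : Monoid.End (FreeGroup X)} (hχ : χ ∈ Φ) (n) (hn : n ∈ K) :
          hP₀.induced χ hχ n ∈ K := by
        obtain ⟨y, hy, rfl⟩ := hn
        exact ⟨χ y, isInvariant_ascending χ hχ y hy, rfl⟩
      have hSK : S ⊆ K := fun n hn => ⟨Function.surjInv hπ n, Subgroup.subset_normalClosure
        (subset_relators_ascending (Or.inr ⟨n, hn, rfl⟩)), Function.surjInv_eq hπ n⟩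
      obtain ⟨y, hy, hyx⟩ := hS K (Subgroup.Normal.map inferInstance π hπ) hSK (hK hφΦ) (hK hφΦ')
        (hK hψΦ) (hK hψΦ') (show π x ∈ pbar.ker from hx)
      have hyx' : y⁻¹ * x ∈ Subgroup.normalClosure P.relators :=
        Subgroup.normalClosure_mono (relators_ascending_mono Set.subset_union_left)
          (QuotientGroup.eq.1 hyx)
      simpa using mul_mem hy hyx'
  refine ⟨X, P, ⟨‹_›, Set.finite_empty, ?_, hR₀fin.union (hSfin.image _)⟩, isInvariant_ascending,
    ⟨(QuotientGroup.quotientKerEquivOfSurjective p₀ hp₀).symm.trans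
      (QuotientGroup.quotientMulEquivOfEq hker.symm)⟩⟩
  exact Set.toFinite Φ

theorem theorem5p11 {G : Type*} [Group G] [Group.IsFinitelyPresented G]
    (H : Subgroup G) [H.Normal] (hH : H.FG)
    (hGH : Nonempty (G ⧸ H ≃* Multiplicative (ℤ × ℤ))) :
    IsInvariantlyFinitelyLPresented H := by
  obtain ⟨e⟩ := hGH
  obtain ⟨X, _, p₀, hp₀⟩ := Group.fg_iff_exists_freeGroup_hom_surjective_finite.1
    ((Group.fg_iff_subgroup_fg H).2 hH)
  let q : G →* Multiplicative (ℤ × ℤ) := e.toMonoidHom.comp (QuotientGroup.mk' H)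
  have hq : Function.Surjective q := e.surjective.comp (QuotientGroup.mk'_surjective H)
  have hqH (g) : q g = 1 ↔ g ∈ H := by simp [q]
  obtain ⟨s, hs⟩ := hq (.ofAdd (1, 0))
  obtain ⟨t, ht⟩ := hq (.ofAdd (0, 1))
  have hst (i j : ℤ) : q (s ^ i * t ^ j) = .ofAdd (i, j) := by
    simp [hs, ht, ← ofAdd_zsmul, ← ofAdd_add]
  refine isInvariantlyFinitelyLPresented_of_freeGroup_hom p₀ hp₀ s t ?_ (fun g => ?_)
    fun h hh i j hij => ?_
  · rw [← hqH]
    simp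
  · refine ⟨g * (s ^ (q g).toAdd.1 * t ^ (q g).toAdd.2)⁻¹, ?_,
      (q g).toAdd.1, (q g).toAdd.2, by group⟩
    rw [← hqH, map_mul, map_inv, hst, mul_inv_eq_one]
    rfl
  · have := congrArg q hij
    rw [mul_assoc, map_mul, (hqH h).2 hh, one_mul, hst, map_one, ofAdd_eq_one] at this
    exact Prod.mk_eq_zero.1 this
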